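/- All matroids are finite. Write $E(M)$ for the ground set, $r_M$ for the rank function and $r(M)=r_M(E(M))$ for the rank of a matroid $M$. For a matroid $M$ without loops, the characteristic polynomial is $\chi_M(\lambda)=\sum_{F}\mu_M(\emptyset,F)\,\lambda^{r(M)-r_M(F)}$, where $F$ runs over the flats of $M$ and $\mu_M$ is the Möbius function of the lattice of flats (if $M$ has a loop, $\chi_M=0$). A tree-decomposition of $M$ is a pair $(T,\tau)$ of a finite tree $T$ and an arbitrary map $\tau\colon E(M)\to V(T)$. For a vertex $v$ of $T$, let $T_1,\dots,T_c$ be the components of $T-v$ and $B_j=\tau^{-1}(V(T_j))$. The node width of $v$ is $r(M)-\sum_{j=1}^{c}\bigl(r(M)-r_M(E(M)\setminus B_j)\bigr)$. The width of $(T,\tau)$ is the maximum of the node widths of the vertices of $T$, and the tree-width of $M$ is the minimum width of a tree-decomposition of $M$. **Corollary 1.5.** Let $k\ge 0$ be an integer, and let $\mathcal M$ be a class of matroids that is closed under isomorphism and under taking minors and all of whose members have tree-width at most $k$. Then exactly one of the following holds: 1. $\mathcal M$ contains all simple matroids of rank two; 2. there is a real number $\lambda_{\mathcal M}$ such that $\chi_M(\lambda)>0$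 for every loopless matroid $M\in\mathcal M$ and every real $\lambda>\lambda_{\mathcal M}$. -/

import Mathlib

universe u

/-- A matroid is simple if it has no loops and no pair of distinct parallel elements, that is, if
all subsets of its ground set with at most two elements are independent
(the case `e = f` excludes loops). -/
def Matroid.IsSimple {α : Type*} (M : Matroid α) : Prop :=
  ∀ e ∈ M.E, ∀ f ∈ M.E, M.Indep {e, f}

/-- Two matroids are isomorphic if there is a bijection between their ground sets that preserves
independence in both directions. -/
def Matroid.IsIsomorphic {α β : Type*} (M : Matroid α) (N : Matroid β) : Prop :=
  ∃ e : M.E ≃ N.E, ∀ I : Set M.E,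
    M.Indep (Subtype.val '' I) ↔ N.Indep (Subtype.val '' (e '' I))

/-- The rank `r(X)` as a natural number; used for finite matroids only, where all ranks are
finite. -/
noncomputable def Matroid.natRk {α : Type*} (M : Matroid α) (X : Set α) : ℕ :=
  (M.eRk X).toNat

/-- The flats of `M`; as a subtype of `Set α` it is ordered by inclusion. -/
abbrev Matroid.FlatLattice {α : Type*} (M : Matroid α) : Type _ :=
  {F : Set α // M.IsFlat F}

instance Matroid.finite_flatLattice {α : Type*} (M : Matroid α) [M.Finite] :
    Finite M.FlatLattice :=
  (M.ground_finite.finite_subsets.subset fun _ hF => hF.subset_ground).to_subtype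

noncomputable instance Matroid.fintypeFlatLattice {α : Type*} (M : Matroid α) [M.Finite] :
    Fintype M.FlatLattice :=
  Fintype.ofFinite _

open Classical in
noncomputable instance Matroid.locallyFiniteOrderFlatLattice {α : Type*} (M : Matroid α)
    [M.Finite] : LocallyFiniteOrder M.FlatLattice :=
  Fintype.toLocallyFiniteOrder

/-- The least flat: the closure of the empty set. It is `∅` when `M` is loopless. -/
def Matroid.leastFlat {α : Type*} (M : Matroid α) : M.FlatLattice :=
  ⟨M.closure ∅, M.isFlat_closure ∅⟩

open Classical in
/-- The characteristic polynomial of a finite matroid: the sum over all flats `F` of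
`μ(∅, F) X ^ (r(E) - r(F))`, with `μ` the Möbius function of the lattice of flats, if the matroid
has no loop, and zero if it has a loop. -/
noncomputable def Matroid.charPoly {α : Type*} (M : Matroid α) [M.Finite] : Polynomial ℤ :=
  if M.Loopless then
    ∑ F : M.FlatLattice,
      Polynomial.C (IncidenceAlgebra.mu ℤ M.leastFlat F) *
        Polynomial.X ^ (M.natRk M.E - M.natRk F.1)
  else 0

/-- A tree-decomposition of `M`: a finite tree together with an arbitrary map from the ground set
to the vertices of the tree. (The map is total on the ambient type for convenience; only its values
on `M.E` are ever used.) -/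
structure Matroid.TreeDecomposition {α : Type*} (M : Matroid α) where
  /-- the vertices of the tree -/
  V : Type
  finite_V : Finite V
  /-- the tree -/
  T : SimpleGraph V
  isTree : T.IsTree
  /-- the vertex to which an element is assigned -/
  τ : α → V

/-- The components of the graph obtained from the tree by removing the vertex `v`. -/
abbrev Matroid.TreeDecomposition.Branch {α : Type*} {M : Matroid α} (D : M.TreeDecomposition)
    (v : D.V) : Type :=
  (D.T.induce {w | w ≠ v}).ConnectedComponent

/-- The set of elements of `M` that are assigned to the vertices of the component `c` of the tree
without `v`: one of the sets displayed by `v`. -/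
def Matroid.TreeDecomposition.displayed {α : Type*} {M : Matroid α} (D : M.TreeDecomposition)
    (v : D.V) (c : D.Branch v) : Set α :=
  {e | e ∈ M.E ∧ D.τ e ∈ Subtype.val '' c.supp}

/-- The rank defect `r(M) - r(E(M) - B)` of a set `B` of elements. -/
noncomputable def Matroid.rankDefect {α : Type*} (M : Matroid α) (B : Set α) : ℤ :=
  (M.natRk M.E : ℤ) - M.natRk (M.E \ B)

/-- The node width of `v`: the rank of `M` minus the sum of the rank defects of the sets displayed
by `v` (a sum over the finitely many components of the tree without `v`). -/
noncomputable def Matroid.TreeDecomposition.nodeWidth {α : Type*} {M : Matroid α}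
    (D : M.TreeDecomposition) (v : D.V) : ℤ :=
  (M.natRk M.E : ℤ) - ∑ᶠ c : D.Branch v, M.rankDefect (D.displayed v c)

/-- The width of a tree-decomposition: the maximum of the node widths of the (finitely many, and at
least one) vertices of the tree. -/
noncomputable def Matroid.TreeDecomposition.width {α : Type*} {M : Matroid α}
    (D : M.TreeDecomposition) : ℤ :=
  ⨆ v : D.V, D.nodeWidth v

/-- The tree-width of a finite matroid: the minimum width of its tree-decompositions. For a finite
matroid every width is non-negative, so nothing is lost by taking the minimum in `ℕ`; and the
tree-decomposition with one vertex has width `r(M)`, so there is something to minimize. -/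
noncomputable def Matroid.treeWidth {α : Type*} (M : Matroid α) : ℕ :=
  sInf {n : ℕ | ∃ D : M.TreeDecomposition, D.width = n}

/-- A class of (finite) matroids, given by its members on each type `α`, is minor-closed if with
each matroid it contains all matroids isomorphic to it and all its minors. -/
structure IsMinorClosedClass (𝓜 : ∀ α : Type u, Set (Matroid α)) : Prop where
  finite : ∀ (α : Type u) (M : Matroid α), M ∈ 𝓜 α → M.Finite
  iso_mem : ∀ (α β : Type u) (M : Matroid α) (N : Matroid β),
    M ∈ 𝓜 α → M.IsIsomorphic N → N ∈ 𝓜 β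
  minor_mem : ∀ (α : Type u) (M N : Matroid α), M ∈ 𝓜 α → N ≤m M → N ∈ 𝓜 α

/-- The class contains all simple (finite) matroids of rank two. -/
def ContainsSimpleRankTwo (𝓜 : ∀ α : Type u, Set (Matroid α)) : Prop :=
  ∀ (α : Type u) (M : Matroid α), M.Finite → M.IsSimple → M.eRank = 2 → M ∈ 𝓜 α

/-! For a loopless matroid, `charPoly` evaluates to `subsetPoly`, the signed sum over all subsets,
which obeys deletion-contraction. A simple rank-two matroid with m elements gives (x - 1)(x + 1 -
m), so a class containing all of these has roots m - 1 beyond every bound, and the two alternatives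
exclude each other.

Suppose now that some simple rank-two matroid M₀ is missing. Then every simple rank-two matroid in
the class has at most |M₀| elements. For a cocircuit C of a loopless M, deletion-contraction gives
χ(M) ≥ (x - |C|) χ(M \ C), provided smaller loopless minors are positive at x
(`PosBelow.mul_le_subsetPoly`). Hence if every non-empty simple minor has a cocircuit of size at
most d, induction gives positivity for x > d (`subsetPoly_pos`).

Tree-width supplies the cocircuit: some set B of rank at most k has a non-spanning complement
(`exists_rankDefect_ne_zero`), so B contains a cocircuit, and a simple matroid of rank at most k
with bounded lines has boundedly many elements (`ncard_ground_le_pointBound`). The class is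
minor-closed, so the tree-width bound applies to each minor directly. -/

namespace Matroid

variable {α : Type*} {M : Matroid α} {e : α} {X : Set α} {x : ℝ}

/-! ### The corank generating function and deletion-contraction. -/

instance delete_finite_of_finite (M : Matroid α) [M.Finite] (D : Set α) : (M ＼ D).Finite :=
  ⟨M.ground_finite.subset (M.delete_subset_ground D)⟩

instance contract_finite_of_finite (M : Matroid α) [M.Finite] (C : Set α) : (M ／ C).Finite :=
  ⟨M.ground_finite.subset (M.contract_ground_subset_ground C)⟩

lemma coe_natRk (M : Matroid α) [M.RankFinite] (X : Set α) : (M.natRk X : ℕ∞) = M.eRk X :=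
  ENat.natCast_toNat (M.isRkFinite_set X).eRk_lt_top.ne

lemma natRk_mono (M : Matroid α) [M.RankFinite] {X Y : Set α} (h : X ⊆ Y) :
    M.natRk X ≤ M.natRk Y := by
  rw [← Nat.cast_le (α := ℕ∞), coe_natRk, coe_natRk]
  exact M.eRk_mono h

lemma natRk_delete (M : Matroid α) {D : Set α} (h : Disjoint X D) :
    (M ＼ D).natRk X = M.natRk X := by
  rw [natRk, natRk, delete_eq_restrict, restrict_eRk_eq', ← Set.inter_sdiff_assoc,
    (h.mono_left Set.inter_subset_left).sdiff_eq_left, eRk_inter_ground]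

lemma IsNonloop.natRk_contract_add_one [M.Finite] (he : M.IsNonloop e) (h : X ⊆ M.E \ {e}) :
    (M ／ {e}).natRk X + 1 = M.natRk (insert e X) := by
  rw [← Nat.cast_inj (R := ℕ∞), Nat.cast_add, coe_natRk, coe_natRk]
  obtain ⟨J, hJ⟩ := (M ／ {e}).exists_isBasis X h
  have heJ : e ∉ J := fun h' ↦ (h (hJ.subset h')).2 rfl
  have hJ' := (indep_singleton.2 he).union_isBasis_union_of_contract_isBasis hJ
  rw [Set.union_singleton, Set.union_singleton] at hJ'
  rw [hJ.eRk_eq_encard, hJ'.eRk_eq_encard, Set.encard_insert_of_notMem heJ, Nat.cast_one]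

/-- The corank generating function `∑ A ⊆ E, (-1) ^ |A| * x ^ (r(M) - r(A))`. -/
noncomputable def subsetPoly (M : Matroid α) [M.Finite] (x : ℝ) : ℝ :=
  ∑ A ∈ M.ground_finite.toFinset.powerset, (-1) ^ A.card * x ^ (M.natRk M.E - M.natRk (A : Set α))

lemma subsetPoly_congr {M N : Matroid α} [M.Finite] [N.Finite] (h : M = N) (x : ℝ) :
    M.subsetPoly x = N.subsetPoly x := by
  subst h
  rfl

/-- Each set A avoiding e is paired with A ∪ {e}; the identities for loops, nonloops and coloops all
start from this pairing. -/
lemma subsetPoly_eq_of_mem [M.Finite] (he : e ∈ M.E) (x : ℝ) :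
    M.subsetPoly x = ∑ A ∈ (M ＼ {e}).ground_finite.toFinset.powerset,
      (-1) ^ A.card * (x ^ (M.natRk M.E - M.natRk (A : Set α)) -
        x ^ (M.natRk M.E - M.natRk (insert e (A : Set α)))) := by
  classical
  have hE : M.ground_finite.toFinset = insert e (M ＼ {e}).ground_finite.toFinset := by
    ext a
    by_cases h : a = e <;> simp [h, he]
  rw [subsetPoly, hE, Finset.sum_powerset_insert (by simp), ← Finset.sum_add_distrib]
  refine Finset.sum_congr rfl fun A hA ↦ ?_
  have heA : e ∉ A := fun h ↦ by simpa using Finset.mem_powerset.1 hA h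
  rw [Finset.card_insert_of_notMem heA, Finset.coe_insert]
  ring

lemma IsLoop.subsetPoly_eq_zero [M.Finite] (he : M.IsLoop e) (x : ℝ) : M.subsetPoly x = 0 := by
  rw [subsetPoly_eq_of_mem he.mem_ground]
  refine Finset.sum_eq_zero fun A hA ↦ ?_
  have : M.closure (insert e (A : Set α)) = M.closure A :=
    closure_insert_eq_of_mem_closure (M.closure_subset_closure (Set.empty_subset _) he)
  rw [natRk, natRk, natRk, ← M.eRk_closure_eq (insert e _), this, eRk_closure_eq, sub_self,
    mul_zero]

lemma subset_of_mem_powerset_toFinset {s : Set α} (hs : s.Finite) {A : Finset α}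
    (hA : A ∈ hs.toFinset.powerset) : (A : Set α) ⊆ s := by
  simpa using hA

lemma IsNonloop.subsetPoly_contract [M.Finite] (he : M.IsNonloop e) (x : ℝ) :
    (M ／ {e}).subsetPoly x = ∑ A ∈ (M ＼ {e}).ground_finite.toFinset.powerset,
      (-1) ^ A.card * x ^ (M.natRk M.E - M.natRk (insert e (A : Set α))) := by
  refine Finset.sum_congr rfl fun A hA ↦ ?_
  have h1 := he.natRk_contract_add_one (subset_of_mem_powerset_toFinset _ hA)
  have h2 := he.natRk_contract_add_one subset_rfl
  rw [Set.insert_sdiff_singleton, Set.insert_eq_of_mem he.mem_ground] at h2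
  rw [← h1, ← h2, Nat.add_sub_add_right, contract_ground]

lemma natRk_ground_sdiff_singleton [M.Finite] (he : M.E ⊆ M.closure (M.E \ {e})) :
    M.natRk (M.E \ {e}) = M.natRk M.E := by
  rw [natRk, natRk, ← M.eRk_closure_eq (M.E \ {e}),
    (M.closure_subset_ground _).antisymm he]

lemma IsNonloop.subsetPoly_eq_sub [M.Finite] (he : M.IsNonloop e) (he' : ¬ M.IsColoop e) (x : ℝ) :
    M.subsetPoly x = (M ＼ {e}).subsetPoly x - (M ／ {e}).subsetPoly x := by
  rw [he.subsetPoly_contract, subsetPoly_eq_of_mem he.mem_ground, subsetPoly,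
    ← Finset.sum_sub_distrib]
  refine Finset.sum_congr rfl fun A hA ↦ ?_
  have hA := subset_of_mem_powerset_toFinset _ hA
  rw [isColoop_iff_sdiff_closure, not_not] at he'
  rw [natRk_delete _ (Set.disjoint_of_subset_left hA Set.disjoint_sdiff_left), delete_ground,
    natRk_delete _ Set.disjoint_sdiff_left, natRk_ground_sdiff_singleton he'.ge]
  ring

lemma IsColoop.subsetPoly_eq_mul [M.Finite] (he : M.IsColoop e) (x : ℝ) :
    M.subsetPoly x = (x - 1) * (M ＼ {e}).subsetPoly x := by
  -- Contracting a coloop is the same as deleting it, so the formula for the contraction evaluates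
  -- the half of the sum over sets containing e.
  have hc := (subsetPoly_congr (contract_eq_delete_of_subset_coloops (Set.singleton_subset_iff.2 he))
    x).symm.trans (he.isNonloop.subsetPoly_contract x)
  rw [sub_mul, one_mul]
  nth_rw 2 [hc]
  rw [subsetPoly_eq_of_mem he.mem_ground, subsetPoly, Finset.mul_sum, ← Finset.sum_sub_distrib]
  refine Finset.sum_congr rfl fun A hA ↦ ?_
  have hA : (A : Set α) ⊆ M.E \ {e} := subset_of_mem_powerset_toFinset _ hA
  have h2 := he.isNonloop.natRk_contract_add_one subset_rfl
  rw [Set.insert_sdiff_singleton, Set.insert_eq_of_mem he.mem_ground,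
    contract_eq_delete_of_subset_coloops (Set.singleton_subset_iff.2 he),
    natRk_delete _ Set.disjoint_sdiff_left] at h2
  rw [natRk_delete _ (Set.disjoint_of_subset_left hA Set.disjoint_sdiff_left), delete_ground,
    natRk_delete _ Set.disjoint_sdiff_left, ← h2, Nat.sub_add_comm (M.natRk_mono hA), pow_succ]
  ring

lemma subsetPoly_of_ground_eq_empty [M.Finite] (h : M.E = ∅) (x : ℝ) : M.subsetPoly x = 1 := by
  simp [subsetPoly, h]

end Matroid

/-! ### Positivity from small cocircuits. -/

namespace Matroid

variable {α : Type*} {M : Matroid α} {e : α} {X : Set α} {x : ℝ}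

lemma ncard_ground_delete_singleton_lt [M.Finite] (he : e ∈ M.E) :
    (M ＼ {e}).E.ncard < M.E.ncard :=
  Set.ncard_lt_ncard (Set.sdiff_singleton_ssubset.2 he) M.ground_finite

lemma ncard_ground_contract_singleton_lt [M.Finite] (he : e ∈ M.E) :
    (M ／ {e}).E.ncard < M.E.ncard :=
  Set.ncard_lt_ncard (Set.sdiff_singleton_ssubset.2 he) M.ground_finite

lemma delete_isMinor' (M : Matroid α) (D : Set α) : M ＼ D ≤m M := by
  simpa using M.contract_delete_isMinor ∅ D

lemma contract_isMinor' (M : Matroid α) (C : Set α) : M ／ C ≤m M := by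
  simpa using M.contract_delete_isMinor C ∅

lemma delete_loopless [M.Loopless] (D : Set α) : (M ＼ D).Loopless :=
  (M.delete_isRestriction D).loopless

lemma IsMinor.finite_of_finite {N : Matroid α} [M.Finite] (h : N ≤m M) : N.Finite :=
  ⟨M.ground_finite.subset h.subset⟩

/-- All loopless minors of `M` with fewer than `n` elements have positive corank generating
function at `x`. -/
def PosBelow (M : Matroid α) (x : ℝ) (n : ℕ) : Prop :=
  ∀ (N : Matroid α) [N.Finite], N ≤m M → N.Loopless → N.E.ncard < n → 0 < N.subsetPoly x

lemma PosBelow.isMinor {N : Matroid α} {n : ℕ} (h : M.PosBelow x n) (hN : N ≤m M) :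
    N.PosBelow x n :=
  fun N' _ hN' hl hn ↦ h N' (hN'.trans hN) hl hn

lemma PosBelow.nonneg {n : ℕ} [M.Finite] (h : M.PosBelow x n) (hn : M.E.ncard < n) :
    0 ≤ M.subsetPoly x := by
  by_cases hl : M.Loopless
  · exact (h M IsMinor.refl hl hn).le
  rw [loopless_iff_forall_not_isLoop] at hl
  push Not at hl
  obtain ⟨e, -, he⟩ := hl
  exact (he.subsetPoly_eq_zero x).ge

/-- The contraction term subtracted is non-negative. Only proper minors enter, so size n itself is
allowed. -/
lemma PosBelow.subsetPoly_le_delete_singleton {n : ℕ} [M.Finite] (h : M.PosBelow x n)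
    (hn : M.E.ncard ≤ n) (he : e ∈ M.E) (he' : ¬ M.IsColoop e) :
    M.subsetPoly x ≤ (M ＼ {e}).subsetPoly x := by
  by_cases hl : M.IsLoop e
  · rw [hl.subsetPoly_eq_zero]
    exact (h.isMinor (M.delete_isMinor' _)).nonneg ((ncard_ground_delete_singleton_lt he).trans_le hn)
  rw [(isNonloop_of_not_isLoop he hl).subsetPoly_eq_sub he', sub_le_self_iff]
  exact (h.isMinor (M.contract_isMinor' _)).nonneg
    ((ncard_ground_contract_singleton_lt he).trans_le hn)

lemma PosBelow.subsetPoly_le_delete {n : ℕ} [M.Finite] (h : M.PosBelow x n)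
    (hn : M.E.ncard < n) (hX : M.Coindep X) :
    M.subsetPoly x ≤ (M ＼ X).subsetPoly x := by
  have hfin : X.Finite := M.ground_finite.subset hX.subset_ground
  induction X, hfin using Set.Finite.induction_on with
  | empty => exact (subsetPoly_congr (M.delete_empty).symm x).le
  | @insert e X heX _ ih =>
    refine (ih (hX.subset (Set.subset_insert _ _))).trans ?_
    have heE : e ∈ (M ＼ X).E := ⟨hX.subset_ground (Set.mem_insert _ _), heX⟩
    have hlt : (M ＼ X).E.ncard < n :=
      (Set.ncard_le_ncard (M.delete_subset_ground X) M.ground_finite).trans_lt hn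
    refine ((h.isMinor (M.delete_isMinor' X)).subsetPoly_le_delete_singleton hlt.le heE ?_).trans_eq
      (subsetPoly_congr (by rw [delete_delete, Set.union_singleton]) x)
    -- Since X ∪ {e} is coindependent, its complement still spans e, so e is not a coloop after X is
    -- deleted.
    rw [isColoop_iff_notMem_closure_compl heE, not_not, delete_ground, Set.sdiff_sdiff,
      Set.union_singleton, delete_closure_eq_of_disjoint, hX.closure_compl]
    · exact heE
    · exact Set.disjoint_sdiff_left.mono_right (Set.subset_insert _ _)

/-- For e in C, induction bounds χ(M \ e) below by (x - |C| + 1) χ(M \ C), while χ(M / e) ≤ χ(M / e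
\ (C - e)) = χ(M \ C). Subtracting lowers the factor by one. -/
lemma PosBelow.mul_le_subsetPoly {n m : ℕ} [M.Finite] [M.Loopless] (h : M.PosBelow x n)
    (hn : M.E.ncard ≤ n) {C : Set α} (hC : M.IsCocircuit C) (hm : C.ncard = m) :
    (x - m) * (M ＼ C).subsetPoly x ≤ M.subsetPoly x := by
  induction m generalizing M C with
  | zero =>
    rw [Set.ncard_eq_zero (M.ground_finite.subset hC.subset_ground)] at hm
    exact absurd hm hC.nonempty.ne_empty
  | succ m ih =>
    obtain ⟨e, he⟩ := hC.nonempty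
    have heE := hC.subset_ground he
    obtain rfl | hne := eq_or_ne C {e}
    · have hm0 : m = 0 := by simpa using hm.symm
      subst hm0
      rw [(singleton_isCocircuit.1 hC).subsetPoly_eq_mul]
      simp
    have hfin := M.ground_finite.subset hC.subset_ground
    have hss : {e} ⊂ C := (Set.singleton_subset_iff.2 he).ssubset_of_ne hne.symm
    have hcol : ¬ M.IsColoop e := fun hcol ↦
      hne ((singleton_isCocircuit.2 hcol).eq_of_subset_isCircuit hC hss.subset).symm
    have : (M ＼ {e}).Loopless := delete_loopless _
    have h1 := ih (M := M ＼ {e}) (h.isMinor (M.delete_isMinor' _))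
      ((ncard_ground_delete_singleton_lt heE).le.trans hn) (hC.delete_isCocircuit hss)
      (by rw [Set.ncard_sdiff_singleton_of_mem he, hm, Nat.add_sub_cancel])
    rw [subsetPoly_congr (show M ＼ {e} ＼ (C \ {e}) = M ＼ C by
      rw [delete_delete, Set.union_sdiff_cancel hss.subset])] at h1
    have hco : M.Coindep (C \ {e}) := hC.sdiff_singleton_indep he
    have h2 := (h.isMinor (M.contract_isMinor' {e})).subsetPoly_le_delete
      ((ncard_ground_contract_singleton_lt heE).trans_le hn)
      (hco.coindep_contract_of_disjoint (C := {e}) Set.disjoint_sdiff_left)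
    -- Only e survives of the cocircuit, so it is a coloop and contracting it amounts to deleting
    -- it.
    have hcol' : (M ＼ (C \ {e})).IsColoop e := by
      rw [← singleton_isCocircuit]
      exact hC.delete_sdiff_isCocircuit hss.subset (Set.singleton_nonempty e)
    rw [subsetPoly_congr (show M ／ {e} ＼ (C \ {e}) = M ＼ C by
      rw [contract_delete_comm _ Set.disjoint_sdiff_right,
        contract_eq_delete_of_subset_coloops (Set.singleton_subset_iff.2 hcol'), delete_delete,
        Set.sdiff_union_of_subset hss.subset])] at h2
    rw [(isNonloop_of_loopless heE).subsetPoly_eq_sub hcol]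
    push_cast
    linarith

lemma IsSimple.loopless (h : M.IsSimple) : M.Loopless := by
  rw [loopless_iff_forall_isNonloop]
  intro e he
  simpa using h e he e he

/-- If every non-empty simple minor of `M` has a cocircuit with at most `d` elements, then the
corank generating function of a loopless minor of `M` is positive to the right of `d`. -/
theorem subsetPoly_pos [M.Finite] {d : ℕ} (hx : d < x)
    (h : ∀ N : Matroid α, N ≤m M → N.IsSimple → N.E.Nonempty →
      ∃ C, N.IsCocircuit C ∧ C.ncard ≤ d) (n : ℕ) : M.PosBelow x n := by
  induction n with
  | zero => exact fun N _ _ _ h ↦ absurd h (Nat.not_lt_zero _)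
  | succ n ih =>
    intro N _ hN hl hn
    obtain hE | hE := N.E.eq_empty_or_nonempty
    · simp [subsetPoly_of_ground_eq_empty hE]
    by_cases hs : N.IsSimple
    · obtain ⟨C, hC, hCd⟩ := h N hN hs hE
      refine lt_of_lt_of_le (mul_pos ?_ ?_)
        ((ih.isMinor hN).mul_le_subsetPoly (Nat.lt_succ_iff.1 hn) hC rfl)
      · have : (C.ncard : ℝ) ≤ d := by exact_mod_cast hCd
        linarith
      obtain ⟨e, he⟩ := hC.nonempty
      refine ih _ ((N.delete_isMinor' C).trans hN) (delete_loopless _)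
        ((Set.ncard_lt_ncard ?_ N.ground_finite).trans_le (Nat.lt_succ_iff.1 hn))
      exact ⟨N.delete_subset_ground C, fun hss ↦ (hss (hC.subset_ground he)).2 he⟩
    rw [IsSimple] at hs
    push Not at hs
    obtain ⟨e, he, f, hf, hef⟩ := hs
    have henl := N.isNonloop_of_loopless he
    have hne : e ≠ f := by
      rintro rfl
      exact hef (by simpa using henl)
    have hcl : f ∈ N.closure {e} := by
      rw [(indep_singleton.2 henl).mem_closure_iff_of_notMem hne.symm, Set.pair_comm]
      exact (not_indep_iff (Set.pair_subset he hf)).1 hef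
    have hcl' : e ∈ N.closure {f} := (N.isNonloop_of_loopless hf).mem_closure_comm henl |>.2 hcl
    -- As f is parallel to e, the contraction term vanishes: deleting e leaves the value unchanged.
    have hloop : (N ／ {e}).IsLoop f :=
      contract_isLoop_iff_mem_closure.2 ⟨hcl, hne.symm⟩
    rw [henl.subsetPoly_eq_sub, hloop.subsetPoly_eq_zero, sub_zero]
    · exact ih _ ((N.delete_isMinor' _).trans hN) (delete_loopless _)
        ((ncard_ground_delete_singleton_lt he).trans_le (Nat.lt_succ_iff.1 hn))
    rw [isColoop_iff_notMem_closure_compl he, not_not]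
    have hsub : {f} ⊆ N.E \ {e} := Set.singleton_subset_iff.2 ⟨hf, hne.symm⟩
    exact N.closure_subset_closure hsub hcl'

end Matroid

/-! ### The characteristic polynomial as a sum over subsets. -/

namespace Matroid

variable {α : Type*}

/-- The closure of a set of elements, as an element of the lattice of flats. -/
def flatClosure (M : Matroid α) (A : Finset α) : M.FlatLattice :=
  ⟨M.closure A, M.isFlat_closure _⟩

lemma flatClosure_le_of_subset {M : Matroid α} {A : Finset α} {F : M.FlatLattice}
    (h : (A : Set α) ⊆ F.1) : M.flatClosure A ≤ F := by
  change M.closure A ⊆ F.1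
  rw [← F.2.closure]
  exact M.closure_subset_closure h

lemma leastFlat_le {M : Matroid α} (F : M.FlatLattice) : M.leastFlat ≤ F := by
  change M.closure ∅ ⊆ F.1
  rw [← F.2.closure]
  exact M.closure_subset_closure (Set.empty_subset _)

open Classical in
/-- The signed count of the sets that span a given flat. -/
noncomputable def signedSpanning (M : Matroid α) [M.Finite] (F : M.FlatLattice) : ℤ :=
  ∑ A ∈ M.ground_finite.toFinset.powerset with M.flatClosure A = F, (-1) ^ A.card

-- Sorting the subsets of F by closure turns the left side into the alternating sum over all subsets
-- of F, which vanishes unless F is empty. This is the recursion that determines the Möbius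
-- function.
open Classical in
lemma sum_Icc_signedSpanning (M : Matroid α) [M.Finite] [M.Loopless] (F : M.FlatLattice) :
    ∑ F' ∈ Finset.Icc M.leastFlat F, M.signedSpanning F' = if M.leastFlat = F then 1 else 0 := by
  have hF : F.1.Finite := M.ground_finite.subset F.2.subset_ground
  have hiff : M.leastFlat = F ↔ hF.toFinset = ∅ := by
    rw [Set.Finite.toFinset_eq_empty, Subtype.ext_iff]
    change M.loops = F.1 ↔ _
    rw [loops_eq_empty, eq_comm]
  have hmem : ∀ A ∈ hF.toFinset.powerset, M.flatClosure A ∈ Finset.Icc M.leastFlat F :=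
    fun A hA ↦ Finset.mem_Icc.2 ⟨leastFlat_le _,
      flatClosure_le_of_subset (subset_of_mem_powerset_toFinset hF hA)⟩
  simp_rw [hiff, ← Finset.sum_powerset_neg_one_pow_card]
  rw [← Finset.sum_fiberwise_of_maps_to hmem]
  refine Finset.sum_congr rfl fun F' hF' ↦ ?_
  rw [signedSpanning]
  congr 1
  ext A
  have hle : F'.1 ⊆ F.1 := (Finset.mem_Icc.1 hF').2
  simp only [Finset.mem_filter, Finset.mem_powerset, Set.Finite.subset_toFinset,
    and_congr_left_iff]
  rintro rfl
  exact ⟨fun hA ↦ (M.subset_closure A hA).trans hle, fun hA ↦ hA.trans F.2.subset_ground⟩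

open Classical in
lemma mu_leastFlat (M : Matroid α) [M.Finite] [M.Loopless] (F : M.FlatLattice) :
    IncidenceAlgebra.mu ℤ M.leastFlat F = M.signedSpanning F := by
  induction F using WellFoundedLT.induction with
  | _ F ih =>
  have h := (IncidenceAlgebra.sum_Icc_mu_right (𝕜 := ℤ) M.leastFlat F).trans
    (M.sum_Icc_signedSpanning F).symm
  rw [← sub_eq_zero, ← Finset.sum_sub_distrib, Finset.sum_eq_single F] at h
  · exact sub_eq_zero.1 h
  · exact fun F' hF' hne ↦ sub_eq_zero.2 (ih F' ((Finset.mem_Icc.1 hF').2.lt_of_ne hne))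
  · exact fun hF ↦ absurd (Finset.mem_Icc.2 ⟨leastFlat_le F, le_rfl⟩) hF

open Classical in
theorem aeval_charPoly (M : Matroid α) [M.Finite] [hM : M.Loopless] (x : ℝ) :
    Polynomial.aeval x M.charPoly = M.subsetPoly x := by
  rw [charPoly, if_pos hM, map_sum, subsetPoly, ← Finset.sum_fiberwise _ M.flatClosure]
  refine Finset.sum_congr rfl fun F _ ↦ ?_
  rw [M.mu_leastFlat, signedSpanning, map_mul, Polynomial.aeval_C, map_pow, Polynomial.aeval_X,
    map_sum, Finset.sum_mul]
  refine Finset.sum_congr rfl fun A hA ↦ ?_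
  rw [← (Finset.mem_filter.1 hA).2, flatClosure, natRk, natRk, natRk, eRk_closure_eq]
  simp

end Matroid

/-! ### Bounding the number of points by the rank and the line length. -/

namespace Matroid

variable {α : Type*} {M : Matroid α} {R : Set α}

lemma IsSimple.restrict (h : M.IsSimple) (hR : R ⊆ M.E) : (M ↾ R).IsSimple := fun e he f hf ↦ by
  rw [restrict_indep_iff]
  exact ⟨h e (hR he) f (hR hf), Set.pair_subset he hf⟩

lemma restrict_isMinor' (hR : R ⊆ M.E) : M ↾ R ≤m M := by
  rw [← delete_compl hR]
  exact M.delete_isMinor' _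

lemma IsSimple.contract_loopless (h : M.IsSimple) {e : α} (he : e ∈ M.E) :
    (M ／ {e}).Loopless := by
  have := h.loopless
  rw [loopless_iff_forall_isNonloop]
  intro f hf
  rw [← indep_singleton, (isNonloop_of_loopless he).contractElem_indep_iff]
  exact ⟨fun h ↦ hf.2 h.symm, h e he f hf.1⟩

/-- An upper bound for the number of points of a matroid of given rank in which the number of points
of rank-two minors is at most `n`. -/
def pointBound (n : ℕ) : ℕ → ℕ
  | 0 => 0
  | k + 1 => pointBound n k * n + 1

/-- Lines through e are the parallel classes of M / e. A maximal S with simple restriction meets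
each of them, for otherwise it could be enlarged. -/
lemma IsSimple.exists_simple_transversal [M.Finite] (h : M.IsSimple) {e : α} (he : e ∈ M.E) :
    ∃ S ⊆ M.E \ {e}, ((M ／ {e}) ↾ S).IsSimple ∧
      ∀ f ∈ M.E \ {e}, ∃ s ∈ S, f ∈ M.closure {e, s} := by
  have hl := h.contract_loopless he
  have hfin : {S | S ⊆ M.E \ {e} ∧ ((M ／ {e}) ↾ S).IsSimple}.Finite :=
    (M ／ {e}).ground_finite.finite_subsets.subset fun S hS ↦ hS.1
  obtain ⟨S, hS⟩ := hfin.exists_maximal ⟨∅, Set.empty_subset _, fun e he ↦ absurd he (by simp)⟩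
  refine ⟨S, hS.prop.1, hS.prop.2, fun f hf ↦ ?_⟩
  by_cases hfS : f ∈ S
  · exact ⟨f, hfS, M.subset_closure _ (Set.pair_subset he hf.1) (by simp)⟩
  have key : ∀ s ∈ S, ¬ (M ／ {e}).Indep {s, f} → f ∈ M.closure {e, s} := by
    intro s hs hsf
    have hmem : f ∈ (M ／ {e}).closure {s} := by
      rw [((M ／ {e}).subsingleton_indep Set.subsingleton_singleton
        (Set.singleton_subset_iff.2 (hS.prop.1 hs))).mem_closure_iff_of_notMem (by
          rintro rfl
          exact hfS hs), Set.pair_comm]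
      exact (not_indep_iff (Set.pair_subset (hS.prop.1 hs) hf)).1 hsf
    rw [contract_closure_eq, Set.singleton_union, Set.pair_comm] at hmem
    exact hmem.1
  have hnot : ¬ ((M ／ {e}) ↾ (insert f S)).IsSimple := fun hs ↦
    hfS (hS.le_of_ge ⟨Set.insert_subset hf hS.prop.1, hs⟩ (Set.subset_insert f S)
      (Set.mem_insert f S))
  rw [IsSimple] at hnot
  push Not at hnot
  obtain ⟨a, ha, b, hb, hab⟩ := hnot
  rw [restrict_ground_eq] at ha hb
  rw [restrict_indep_iff, and_iff_left (Set.pair_subset ha hb)] at hab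
  obtain rfl | ha := ha <;> obtain rfl | hb := hb
  · refine absurd ?_ hab
    simpa using isNonloop_of_loopless (M := M ／ {e}) hf
  · exact ⟨b, hb, key b hb (by rwa [Set.pair_comm])⟩
  · exact ⟨a, ha, key a ha hab⟩
  · exact absurd (restrict_indep_iff.1 (hS.prop.2 a ha b hb)).1 hab

/-- The lines through a point e cover the matroid. They are indexed by a simple minor of rank one
less, and each has at most n points. -/
theorem IsSimple.ncard_ground_le_pointBound [M.Finite] {n k : ℕ} (h : M.IsSimple)
    (hn : ∀ N, N ≤m M → N.IsSimple → N.eRank = 2 → N.E.ncard ≤ n) (hk : M.eRank ≤ k) :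
    M.E.ncard ≤ pointBound n k := by
  classical
  induction k generalizing M with
  | zero =>
    have := h.loopless
    rw [Nat.cast_zero, nonpos_iff_eq_zero, ← eRk_ground, eRk_eq_zero_iff, loops_eq_empty,
      Set.subset_empty_iff] at hk
    simp [hk]
  | succ k ih =>
    obtain hE | ⟨e, he⟩ := M.E.eq_empty_or_nonempty
    · simp [hE]
    obtain ⟨S, hSE, hS, hcov⟩ := h.exists_simple_transversal he
    have hl := h.loopless
    have hSmin : (M ／ {e}) ↾ S ≤m M := (restrict_isMinor' hSE).trans (M.contract_isMinor' _)
    have hSfin : S.Finite := (M ／ {e}).ground_finite.subset hSE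
    have hrk := (isNonloop_of_loopless he).natRk_contract_add_one subset_rfl
    rw [Set.insert_sdiff_singleton, Set.insert_eq_of_mem he] at hrk
    have hScard : S.ncard ≤ pointBound n k := by
      have := hSmin.finite_of_finite
      refine ih hS (fun N hN ↦ hn N (hN.trans hSmin)) ?_
      rw [eRank_restrict]
      refine ((M ／ {e}).eRk_mono hSE).trans ?_
      rw [← eRk_ground, ← coe_natRk, ← hrk, Nat.cast_le] at hk
      rw [← coe_natRk, Nat.cast_le]
      exact Nat.le_of_succ_le_succ hk
    have hline : ∀ s ∈ S, (M.closure {e, s}).ncard ≤ n := fun s hs ↦ by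
      have hcE := M.closure_subset_ground {e, s}
      refine hn _ (restrict_isMinor' hcE) (h.restrict hcE) ?_
      rw [eRank_restrict, eRk_closure_eq, (h e he s (hSE hs).1).eRk_eq_encard, Set.encard_pair]
      exact fun hes ↦ (hSE hs).2 hes.symm
    have hfin : ∀ X, (M.closure X).Finite :=
      fun X ↦ M.ground_finite.subset (M.closure_subset_ground X)
    have hsub : M.ground_finite.toFinset ⊆
        insert e (hSfin.toFinset.biUnion fun s ↦ (hfin {e, s}).toFinset) := fun f hf ↦ by
      rw [Set.Finite.mem_toFinset] at hf
      by_cases hfe : f = e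
      · simp [hfe]
      obtain ⟨s, hs, hfs⟩ := hcov f ⟨hf, hfe⟩
      exact Finset.mem_insert_of_mem (Finset.mem_biUnion.2 ⟨s, by simpa using hs, by simpa using hfs⟩)
    rw [Set.ncard_eq_toFinset_card _ M.ground_finite]
    refine (Finset.card_le_card hsub).trans ((Finset.card_insert_le _ _).trans ?_)
    rw [pointBound, Nat.add_le_add_iff_right]
    refine (Finset.card_biUnion_le_card_mul _ _ n fun s hs ↦ ?_).trans ?_
    · rw [← Set.ncard_eq_toFinset_card _ (hfin _)]
      exact hline s (by simpa using hs)
    · rw [← Set.ncard_eq_toFinset_card _ hSfin]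
      exact Nat.mul_le_mul_right n hScard

end Matroid

/-! ### The two sides of a tree edge. -/

namespace SimpleGraph

variable {V : Type*} {G : SimpleGraph V} {u v w : V}

/-- The vertices of a component of the graph obtained by removing the vertex `v`. -/
def branchVerts {v : V} (c : (G.induce {w | w ≠ v}).ConnectedComponent) : Set V :=
  Subtype.val '' c.supp

lemma mem_branchVerts_iff {c : (G.induce {w | w ≠ v}).ConnectedComponent} :
    u ∈ branchVerts c ↔
      ∃ h : u ≠ v, (G.induce {w | w ≠ v}).connectedComponentMk ⟨u, h⟩ = c := by
  simp [branchVerts, ConnectedComponent.mem_supp_iff]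

lemma mem_branchVerts_of_adj {c : (G.induce {w | w ≠ v}).ConnectedComponent}
    (hu : u ∈ branchVerts c) (h : G.Adj u w) (hw : w ≠ v) : w ∈ branchVerts c := by
  obtain ⟨huv, rfl⟩ := mem_branchVerts_iff.1 hu
  refine mem_branchVerts_iff.2 ⟨hw, ConnectedComponent.sound (Adj.reachable ?_)⟩
  exact h.symm

lemma Walk.exists_adj_mem_branchVerts (p : G.Walk u v)
    {c : (G.induce {w | w ≠ v}).ConnectedComponent} (hu : u ∈ branchVerts c) :
    ∃ w ∈ branchVerts c, G.Adj v w := by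
  induction p with
  | nil => exact absurd rfl (mem_branchVerts_iff.1 hu).1
  | @cons a b d hab p ih =>
    by_cases hb : b = d
    · subst hb
      exact ⟨a, hu, hab.symm⟩
    · exact ih (mem_branchVerts_of_adj hu hab hb)

lemma Walk.mem_branchVerts_or (p : G.Walk u v) (hw : w ≠ v) (hv : v ≠ w) (hvw : G.Adj v w) :
    u ∈ branchVerts ((G.induce {x | x ≠ v}).connectedComponentMk ⟨w, hw⟩) ∨
      u ∈ branchVerts ((G.induce {x | x ≠ w}).connectedComponentMk ⟨v, hv⟩) := by
  induction p with
  | nil => exact .inr (mem_branchVerts_iff.2 ⟨hv, rfl⟩)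
  | @cons a b d hab p ih =>
    by_cases had : a = d
    · subst had
      exact .inr (mem_branchVerts_iff.2 ⟨hv, rfl⟩)
    by_cases haw : a = w
    · subst haw
      exact .inl (mem_branchVerts_iff.2 ⟨hw, rfl⟩)
    exact (ih hw hv hvw).imp (fun h ↦ mem_branchVerts_of_adj h hab.symm had)
      (fun h ↦ mem_branchVerts_of_adj h hab.symm haw)

lemma reachable_deleteEdges_of_mem_branchVerts (hw : w ≠ v)
    (h : u ∈ branchVerts ((G.induce {x | x ≠ v}).connectedComponentMk ⟨w, hw⟩)) :
    (G.deleteEdges {s(v, w)}).Reachable u w := by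
  obtain ⟨hu, h⟩ := mem_branchVerts_iff.1 h
  let f : G.induce {x | x ≠ v} →g G.deleteEdges {s(v, w)} :=
    { toFun := Subtype.val
      map_rel' := fun {a b} hab ↦ by
        rw [deleteEdges_adj]
        refine ⟨hab, fun hs ↦ ?_⟩
        have ha := a.2
        have hb := b.2
        simp only [Set.mem_ofPred_eq] at ha hb
        simp only [Set.mem_singleton_iff, Sym2.eq_iff] at hs
        tauto }
  exact (ConnectedComponent.exact h).map f

lemma IsAcyclic.disjoint_branchVerts (hG : G.IsAcyclic) (hw : w ≠ v) (hv : v ≠ w)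
    (hvw : G.Adj v w) :
    Disjoint (branchVerts ((G.induce {x | x ≠ v}).connectedComponentMk ⟨w, hw⟩))
      (branchVerts ((G.induce {x | x ≠ w}).connectedComponentMk ⟨v, hv⟩)) := by
  rw [Set.disjoint_left]
  intro u h1 h2
  have h1 := reachable_deleteEdges_of_mem_branchVerts hw h1
  have h2 := reachable_deleteEdges_of_mem_branchVerts hv h2
  rw [Sym2.eq_swap] at h2
  exact isBridge_iff.1 (isAcyclic_iff_forall_adj_isBridge.1 hG hvw) (h2.symm.trans h1)

/-- A walk from any vertex places it on at least one side of the edge vw; the edge is a bridge, so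
it is not on both. -/
lemma IsTree.compl_branchVerts (hG : G.IsTree) (hw : w ≠ v) (hv : v ≠ w) (hvw : G.Adj v w) :
    branchVerts ((G.induce {x | x ≠ w}).connectedComponentMk ⟨v, hv⟩) =
      (branchVerts ((G.induce {x | x ≠ v}).connectedComponentMk ⟨w, hw⟩))ᶜ := by
  ext u
  refine ⟨fun h h' ↦ Set.disjoint_left.1 (hG.isAcyclic.disjoint_branchVerts hw hv hvw) h' h,
    fun h ↦ ?_⟩
  obtain ⟨p⟩ := hG.connected u v
  exact (p.mem_branchVerts_or hw hv hvw).resolve_left h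

/-- Moving from v to w and on into a branch away from v strictly shrinks the branch; this makes the
descent in the tree terminate. -/
lemma IsTree.branchVerts_ssubset (hG : G.IsTree) (hw : w ≠ v) (hv : v ≠ w) (hvw : G.Adj v w)
    {c : (G.induce {x | x ≠ w}).ConnectedComponent}
    (hc : c ≠ (G.induce {x | x ≠ w}).connectedComponentMk ⟨v, hv⟩) :
    branchVerts c ⊂ branchVerts ((G.induce {x | x ≠ v}).connectedComponentMk ⟨w, hw⟩) := by
  refine ⟨fun u hu ↦ ?_, fun h ↦ ?_⟩
  · rw [← not_not (a := u ∈ _), ← Set.mem_compl_iff, ← hG.compl_branchVerts hw hv hvw]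
    intro hu'
    obtain ⟨h1, h2⟩ := mem_branchVerts_iff.1 hu
    obtain ⟨_, h2'⟩ := mem_branchVerts_iff.1 hu'
    exact hc (h2.symm.trans h2')
  · exact (mem_branchVerts_iff.1 (h (mem_branchVerts_iff.2 ⟨hw, rfl⟩))).1 rfl

end SimpleGraph

/-! ### A low-rank set with non-spanning complement, and a small cocircuit. -/

namespace Matroid

open SimpleGraph

variable {α : Type*} {M : Matroid α}

lemma TreeDecomposition.nodeWidth_le_width (D : M.TreeDecomposition) (v : D.V) :
    D.nodeWidth v ≤ D.width := by
  have := D.finite_V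
  exact le_ciSup (Set.finite_range _).bddAbove v

/-- Descend to a branch of non-zero defect, displaying B, whose root w has no further such branch
away from v. Only the branch back to v, which displays E \ B, can then contribute at w, so the node
width of w is r(M) - (r(M) - r(B)) = r(B). -/
lemma TreeDecomposition.exists_rankDefect_ne_zero_of_branch [M.Finite] (D : M.TreeDecomposition)
    {k : ℕ} (hk : D.width ≤ k) {v : D.V} (c : D.Branch v)
    (hc : M.rankDefect (D.displayed v c) ≠ 0) :
    ∃ B ⊆ M.E, M.rankDefect B ≠ 0 ∧ M.natRk B ≤ k := by
  have := D.finite_V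
  induction hn : (branchVerts c).ncard using Nat.strong_induction_on generalizing v c with
  | _ n ih =>
  obtain ⟨⟨u, hu⟩, rfl⟩ := c.exists_rep
  obtain ⟨p⟩ := D.isTree.connected u v
  obtain ⟨w, hwc, hvw⟩ := p.exists_adj_mem_branchVerts (mem_branchVerts_iff.2 ⟨hu, rfl⟩)
  obtain ⟨hw, hwc⟩ := mem_branchVerts_iff.1 hwc
  change (D.T.induce {w | w ≠ v}).connectedComponentMk ⟨w, hw⟩ =
    (D.T.induce {w | w ≠ v}).connectedComponentMk ⟨u, hu⟩ at hwc
  change M.rankDefect (D.displayed v ((D.T.induce {w | w ≠ v}).connectedComponentMk ⟨u, hu⟩)) ≠ 0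
    at hc
  change (branchVerts ((D.T.induce {w | w ≠ v}).connectedComponentMk ⟨u, hu⟩)).ncard = n at hn
  rw [← hwc] at hc hn
  set B := D.displayed v ((D.T.induce {w | w ≠ v}).connectedComponentMk ⟨w, hw⟩) with hB
  by_cases hother : ∃ c' : D.Branch w,
      c' ≠ (D.T.induce {x | x ≠ w}).connectedComponentMk ⟨v, hw.symm⟩ ∧
        M.rankDefect (D.displayed w c') ≠ 0
  · obtain ⟨c', hc', hc'0⟩ := hother
    refine ih _ ?_ c' hc'0 rfl
    rw [← hn]
    exact Set.ncard_lt_ncard (D.isTree.branchVerts_ssubset hw hw.symm hvw hc') (Set.toFinite _)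
  push Not at hother
  have hBE : B ⊆ M.E := fun e he ↦ he.1
  refine ⟨B, hBE, hc, ?_⟩
  have hdisp : D.displayed w ((D.T.induce {x | x ≠ w}).connectedComponentMk ⟨v, hw.symm⟩) =
      M.E \ B := by
    have h := D.isTree.compl_branchVerts hw hw.symm hvw
    ext e
    have he := Set.ext_iff.1 h (D.τ e)
    simp only [branchVerts, Set.mem_compl_iff] at he
    simp only [hB, TreeDecomposition.displayed, Set.mem_ofPred_eq, Set.mem_sdiff]
    tauto
  have hwidth := (D.nodeWidth_le_width w).trans hk
  rw [TreeDecomposition.nodeWidth, finsum_eq_single _ _ hother, hdisp, rankDefect,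
    Set.sdiff_sdiff_cancel_left hBE] at hwidth
  omega

lemma TreeDecomposition.exists_rankDefect_ne_zero [M.Finite] (D : M.TreeDecomposition)
    {k : ℕ} (hk : D.width ≤ k) (hM : M.natRk M.E ≠ 0) :
    ∃ B ⊆ M.E, M.rankDefect B ≠ 0 ∧ M.natRk B ≤ k := by
  by_cases h : ∃ (v : D.V) (c : D.Branch v), M.rankDefect (D.displayed v c) ≠ 0
  · obtain ⟨v, c, hc⟩ := h
    exact D.exists_rankDefect_ne_zero_of_branch hk c hc
  push Not at h
  obtain ⟨v⟩ := D.isTree.connected.nonempty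
  -- With all defects zero, every node width equals r(M), so the whole ground set has rank at most
  -- k.
  refine ⟨M.E, subset_rfl, ?_, ?_⟩
  · simpa [rankDefect, natRk] using hM
  · have hwidth := (D.nodeWidth_le_width v).trans hk
    rw [TreeDecomposition.nodeWidth, finsum_congr (h v), finsum_zero] at hwidth
    omega

/-- The tree-decomposition with a single vertex. -/
def trivialDecomposition (M : Matroid α) : M.TreeDecomposition where
  V := Unit
  finite_V := inferInstance
  T := ⊥
  isTree := .of_subsingleton
  τ := fun _ ↦ ()

lemma width_trivialDecomposition (M : Matroid α) :
    M.trivialDecomposition.width = M.natRk M.E := by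
  have h : ∀ v, M.trivialDecomposition.nodeWidth v = M.natRk M.E := fun v ↦ by
    have : IsEmpty (M.trivialDecomposition.Branch v) :=
      ⟨fun c ↦ c.ind fun w ↦ w.2 (Subsingleton.elim (α := Unit) _ _)⟩
    rw [TreeDecomposition.nodeWidth, finsum_of_isEmpty, sub_zero]
  have : Nonempty M.trivialDecomposition.V := ⟨()⟩
  rw [TreeDecomposition.width]
  simp_rw [h]
  exact ciSup_const

lemma exists_treeDecomposition_width_eq (M : Matroid α) :
    ∃ D : M.TreeDecomposition, D.width = M.treeWidth :=
  Nat.sInf_mem (s := {n : ℕ | ∃ D : M.TreeDecomposition, D.width = n})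
    ⟨_, M.trivialDecomposition, M.width_trivialDecomposition⟩

theorem IsSimple.exists_isCocircuit_ncard_le [M.Finite] (h : M.IsSimple) (hE : M.E.Nonempty)
    {n k : ℕ} (hn : ∀ N, N ≤m M → N.IsSimple → N.eRank = 2 → N.E.ncard ≤ n)
    (hk : M.treeWidth ≤ k) : ∃ C, M.IsCocircuit C ∧ C.ncard ≤ pointBound n k := by
  obtain ⟨D, hD⟩ := M.exists_treeDecomposition_width_eq
  have hl := h.loopless
  have hM : M.natRk M.E ≠ 0 := by
    rw [← Nat.cast_ne_zero (R := ℕ∞), coe_natRk, ne_eq, eRk_eq_zero_iff, loops_eq_empty,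
      Set.subset_empty_iff]
    exact hE.ne_empty
  obtain ⟨B, hBE, hB, hBk⟩ := D.exists_rankDefect_ne_zero (k := k) (by rw [hD]; exact_mod_cast hk) hM
  -- A non-zero defect says that E \ B is not spanning, that is, B is codependent and contains a
  -- cocircuit.
  have hdep : M✶.Dep B := by
    rw [← not_indep_iff (M := M✶) hBE, ← coindep_def, coindep_iff_compl_spanning]
    intro hsp
    refine hB ?_
    rw [rankDefect, natRk, natRk, hsp.eRk_eq, eRk_ground, sub_self]
  obtain ⟨C, hCB, hC⟩ := hdep.exists_isCircuit_subset
  have hfin : B.Finite := M.ground_finite.subset hBE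
  refine ⟨C, hC, (Set.ncard_le_ncard hCB hfin).trans ?_⟩
  have hmin : M ↾ B ≤m M := restrict_isMinor' hBE
  have := hmin.finite_of_finite
  refine (h.restrict hBE).ncard_ground_le_pointBound (fun N hN ↦ hn N (hN.trans hmin)) ?_
  rw [eRank_restrict, ← coe_natRk]
  exact_mod_cast hBk

end Matroid

/-! ### Simple matroids of rank two. -/

namespace Matroid

variable {α β : Type*} {M : Matroid α} {X : Set α}

lemma IsSimple.indep_of_encard_le_two (h : M.IsSimple) (hX : X ⊆ M.E) (h2 : X.encard ≤ 2) :
    M.Indep X := by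
  obtain h2 | h2 := h2.eq_or_lt
  · obtain ⟨a, b, -, rfl⟩ := Set.encard_eq_two.1 h2
    exact h a (hX (by simp)) b (hX (by simp))
  obtain rfl | ⟨a, rfl⟩ := Set.encard_le_one_iff_eq.1 (Order.le_of_lt_add_one h2)
  · exact M.empty_indep
  · have := h.loopless
    exact M.subsingleton_indep Set.subsingleton_singleton hX

lemma IsSimple.eRk_eq_min (h : M.IsSimple) (hr : M.eRank ≤ 2) (hX : X ⊆ M.E) :
    M.eRk X = min X.encard 2 := by
  refine le_antisymm (le_min (M.eRk_le_encard X) ((M.eRk_le_eRank X).trans hr)) ?_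
  obtain ⟨I, hIX, hI⟩ := Set.exists_subset_encard_eq (min_le_left X.encard 2)
  rw [← hI]
  refine (h.indep_of_encard_le_two (hIX.trans hX) ?_).encard_le_eRk_of_subset hIX
  exact hI.trans_le (min_le_right _ _)

lemma IsSimple.indep_iff_of_eRank_eq_two (h : M.IsSimple) (hr : M.eRank = 2) :
    M.Indep X ↔ X ⊆ M.E ∧ X.encard ≤ 2 :=
  ⟨fun hX ↦ ⟨hX.subset_ground, hr ▸ hX.encard_le_eRank⟩,
    fun hX ↦ h.indep_of_encard_le_two hX.1 hX.2⟩

lemma IsSimple.isIsomorphic_of_eRank_eq_two {N : Matroid β} [M.Finite] [N.Finite]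
    (hM : M.IsSimple) (hN : N.IsSimple) (hMr : M.eRank = 2) (hNr : N.eRank = 2)
    (hcard : M.E.ncard = N.E.ncard) : M.IsIsomorphic N := by
  have := M.ground_finite.to_subtype
  have := N.ground_finite.to_subtype
  refine ⟨(Finite.equivFinOfCardEq hcard).trans (Finite.equivFin N.E).symm, fun I ↦ ?_⟩
  rw [hM.indep_iff_of_eRank_eq_two hMr, hN.indep_iff_of_eRank_eq_two hNr,
    Subtype.val_injective.encard_image, Subtype.val_injective.encard_image,
    (Equiv.injective _).encard_image]
  simp

lemma IsSimple.subsetPoly_of_eRank_eq_two [M.Finite] (hM : M.IsSimple) (hr : M.eRank = 2)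
    (x : ℝ) : M.subsetPoly x = (x - 1) * (x + 1 - M.E.ncard) := by
  have hrE : M.natRk M.E = 2 := by rw [natRk, eRk_ground, hr]; rfl
  have h2 : 2 ≤ M.E.ncard := by
    have := hr ▸ M.eRank_le_encard_ground
    rw [← M.ground_finite.cast_ncard_eq] at this
    exact_mod_cast this
  have hsum : M.subsetPoly x =
      ∑ A ∈ M.ground_finite.toFinset.powerset, (-1) ^ A.card * x ^ (2 - A.card) := by
    refine Finset.sum_congr rfl fun A hA ↦ ?_
    have hrA : M.natRk (A : Set α) = min A.card 2 := by
      rw [← Nat.cast_inj (R := ℕ∞), coe_natRk,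
        hM.eRk_eq_min hr.le (subset_of_mem_powerset_toFinset _ hA), Set.encard_coe_eq_coe_finsetCard]
      norm_cast
    rw [hrE, hrA]
    congr 2
    omega
  rw [hsum, Finset.sum_powerset_apply_card fun m ↦ (-1 : ℝ) ^ m * x ^ (2 - m),
    ← Set.ncard_eq_toFinset_card _ M.ground_finite]
  obtain ⟨n, hn⟩ := Nat.exists_eq_add_of_le' h2
  rw [hn]
  -- The exponent 2 - m truncates to 0 for m ≥ 2; the vanishing alternating binomial sum evaluates
  -- that tail.
  have halt := congrArg (Int.cast (R := ℝ))
    (Int.alternating_sum_range_choose_of_ne (n := n + 2) (by simp))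
  rw [Finset.sum_range_succ', Finset.sum_range_succ'] at halt ⊢
  simp only [Nat.add_assoc, Nat.reduceAdd, nsmul_eq_mul] at halt ⊢
  push_cast at halt ⊢
  simp only [mul_comm ((Nat.choose _ _ : ℕ) : ℝ)]
  simp at halt ⊢
  linear_combination halt

/-- The uniform matroid of rank two on a finite type with at least two elements. -/
def unifTwo (α : Type*) [Finite α] : Matroid α :=
  (IndepMatroid.ofFinite (E := Set.univ) Set.finite_univ (fun I ↦ I.ncard ≤ 2) (by simp)
    (fun _ J hJ hIJ ↦ (Set.ncard_le_ncard hIJ J.toFinite).trans hJ)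
    (fun I J _ hJ hIJ ↦ by
      obtain ⟨e, heJ, heI⟩ := Set.exists_mem_notMem_of_ncard_lt_ncard hIJ
      refine ⟨e, heJ, heI, ?_⟩
      rw [Set.ncard_insert_of_notMem heI]
      omega)
    (fun _ _ ↦ Set.subset_univ _)).matroid

instance unifTwo_finite (α : Type*) [Finite α] : (unifTwo α).Finite :=
  ⟨Set.finite_univ⟩

lemma unifTwo_indep_iff [Finite α] : (unifTwo α).Indep X ↔ X.ncard ≤ 2 := Iff.rfl

lemma unifTwo_isSimple (α : Type*) [Finite α] : (unifTwo α).IsSimple :=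
  fun e _ f _ ↦ unifTwo_indep_iff.2 (Set.ncard_insert_le e {f} |>.trans (by simp))

lemma unifTwo_eRank [Finite α] (h : 2 ≤ Nat.card α) : (unifTwo α).eRank = 2 := by
  have hle : (unifTwo α).eRank ≤ 2 := by
    rw [← eRk_ground, eRk_le_iff]
    intro I _ hI
    rw [← I.toFinite.cast_ncard_eq]
    exact_mod_cast unifTwo_indep_iff.1 hI
  rw [← eRk_ground, (unifTwo_isSimple α).eRk_eq_min hle subset_rfl, min_eq_right]
  change 2 ≤ (Set.univ : Set α).encard
  rw [← Set.finite_univ.cast_ncard_eq, Set.ncard_univ]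
  exact_mod_cast h

end Matroid

/-! ### The dichotomy. -/

open Matroid

/-- Simple rank-two matroids are determined up to isomorphism by their size, so a larger N would
have a restriction isomorphic to M. -/
lemma ncard_ground_le_of_notMem {𝓜 : ∀ α : Type u, Set (Matroid α)} (h𝓜 : IsMinorClosedClass 𝓜)
    {α β : Type u} {M : Matroid α} {N : Matroid β} [M.Finite] (hM : M.IsSimple) (hMr : M.eRank = 2)
    (hM𝓜 : M ∉ 𝓜 α) (hN𝓜 : N ∈ 𝓜 β) (hN : N.IsSimple) (hNr : N.eRank = 2) :
    N.E.ncard ≤ M.E.ncard := by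
  by_contra! hlt
  have := h𝓜.finite _ _ hN𝓜
  obtain ⟨R, hR, hRcard⟩ := Set.exists_subset_card_eq hlt.le
  have hmin : N ↾ R ≤m N := restrict_isMinor' hR
  have := hmin.finite_of_finite
  have hRs := hN.restrict hR
  have hRr : (N ↾ R).eRank = 2 := by
    rw [eRank_restrict, hN.eRk_eq_min hNr.le hR, min_eq_right]
    rw [← (N.ground_finite.subset hR).cast_ncard_eq, hRcard, M.ground_finite.cast_ncard_eq, ← hMr]
    exact M.eRank_le_encard_ground
  exact hM𝓜 (h𝓜.iso_mem _ _ _ _ (h𝓜.minor_mem _ _ _ hN𝓜 hmin)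
    (hRs.isIsomorphic_of_eRank_eq_two hM hRr hMr hRcard))

lemma ContainsSimpleRankTwo.exists_aeval_charPoly_eq_zero {𝓜 : ∀ α : Type u, Set (Matroid α)}
    (h : ContainsSimpleRankTwo 𝓜) (lam₀ : ℝ) :
    ∃ (α : Type u) (M : Matroid α) (_ : M.Finite), M ∈ 𝓜 α ∧ M.Loopless ∧
      ∃ lam > lam₀, Polynomial.aeval lam M.charPoly = 0 := by
  obtain ⟨n, hn⟩ := exists_nat_gt lam₀
  have hr : (unifTwo (ULift.{u} (Fin (n + 2)))).eRank = 2 := unifTwo_eRank (by simp)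
  have hs := unifTwo_isSimple (ULift.{u} (Fin (n + 2)))
  have hl := hs.loopless
  -- With n + 2 elements the factor x + 1 - (n + 2) vanishes at n + 1, which exceeds the given
  -- bound.
  refine ⟨_, _, unifTwo_finite _, h _ _ (unifTwo_finite _) hs hr, hl, n + 1, by linarith, ?_⟩
  have hE : (unifTwo (ULift.{u} (Fin (n + 2)))).E.ncard = n + 2 := by
    change (Set.univ : Set (ULift.{u} (Fin (n + 2)))).ncard = n + 2
    rw [Set.ncard_univ]
    simp
  rw [aeval_charPoly, hs.subsetPoly_of_eRank_eq_two hr, hE]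
  push_cast
  ring

theorem corollary1p5 (𝓜 : ∀ α : Type u, Set (Matroid α)) (h𝓜 : IsMinorClosedClass 𝓜)
    (k : ℕ) (hk : ∀ (α : Type u) (M : Matroid α), M ∈ 𝓜 α → M.treeWidth ≤ k) :
    Xor (ContainsSimpleRankTwo 𝓜)
      (∃ lam₀ : ℝ, ∀ (α : Type u) (M : Matroid α) [M.Finite], M ∈ 𝓜 α → M.Loopless →
        ∀ lam : ℝ, lam₀ < lam → 0 < Polynomial.aeval lam M.charPoly) := by
  by_cases h : ContainsSimpleRankTwo 𝓜
  · refine .inl ⟨h, fun ⟨lam₀, hpos⟩ ↦ ?_⟩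
    obtain ⟨α, M, hfin, hM, hl, lam, hlam, h0⟩ := h.exists_aeval_charPoly_eq_zero lam₀
    exact (hpos α M hM hl lam hlam).ne' h0
  refine .inr ⟨?_, h⟩
  rw [ContainsSimpleRankTwo] at h
  push Not at h
  obtain ⟨α₀, M₀, hfin₀, hs₀, hr₀, hM₀⟩ := h
  refine ⟨pointBound M₀.E.ncard k, fun α M _ hM hl lam hlam ↦ ?_⟩
  rw [aeval_charPoly]
  -- `PosBelow` concerns strictly fewer elements, so the parameter |E(M)| + 1 is what includes M
  -- itself.
  refine subsetPoly_pos hlam (fun N hNM hN hE ↦ ?_) (M.E.ncard + 1) M IsMinor.refl hl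
    (Nat.lt_succ_self _)
  have hN𝓜 := h𝓜.minor_mem _ _ _ hM hNM
  have := hNM.finite_of_finite
  exact hN.exists_isCocircuit_ncard_le hE (fun N' hN' hs hr ↦ ncard_ground_le_of_notMem h𝓜 hs₀ hr₀
    hM₀ (h𝓜.minor_mem _ _ _ hN𝓜 hN') hs hr) (hk _ _ hN𝓜)
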